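/- Let $\mathbf{Type}$ be an algebraic theory; only the following is used: $\mathbf{Type}$ is a small category with finite products. Conventions. A profunctor $P\colon C ⇸ D$ between small categories is a functor $C^{op}\times D\to\mathbf{Set}$, and a morphism of profunctors is a natural transformation. The composite of $P\colon C⇸D$ and $Q\colon D⇸E$ is the coend $(P\odot Q)(c,e)=\int^{d\in D}P(c,d)\times Q(d,e)$. The collage of $P$ has as objects those of $C$ and those of $D$; its morphisms are those of $C$, those of $D$, the elements of $P(c,d)$ as morphisms $c\to d$, and none from $d$ to $c$. A profunctor $P\colon C⇸\mathbf{Type}$ is algebraic if every $P(c,-)\colon\mathbf{Type}\to\mathbf{Set}$ preserves finite products. A schema $S=(S_e,S_o)$ is a small category $S_e$ (of entities) with an algebraic profunctor $S_o\colon S_e⇸\mathbf{Type}$ (of observables); $\tilde S$ denotes the collage of $S_o$, with inclusion $i_T\colon\mathbf{Type}\to\tilde S$. The category $S\text{-}\mathbf{Inst}$ of instances is the full subcategory of $\mathbf{Set}^{\tilde S}$ on the functors $I$ such that $I\circ i_T$ preserves finite products; the Yoneda embedding gives $\mathbf y\colon\tilde S^{op}\to S\text{-}\mathbf{Inst}$,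 $\mathbf y(x)=\tilde S(x,-)$. A bimodule $M\colon R⇸S$ is a functor $M\colon\tilde R^{op}\to S\text{-}\mathbf{Inst}$ with $M\circ i_T^{op}=\mathbf y\circ i_T^{op}$; a morphism of bimodules is a natural transformation that restricts to the identity on $\mathbf{Type}$. Proposition. Let $R$ and $S$ be schemas. A bimodule $M\colon R⇸S$ is equivalent to a tuple $(M_e,M_t,M_{att},M_{ret})$, where $M_e\colon R_e⇸S_e$ is a profunctor, $M_t\colon R_e⇸\mathbf{Type}$ is an algebraic profunctor, and $M_{att}\colon M_e\odot S_o\Rightarrow M_t$ and $M_{ret}\colon R_o\Rightarrow M_t$ are morphisms of profunctors. Precisely, a bimodule $M$ determines such a tuple by - $M_e(r,s)=M(r)(s)$ and $M_t(r,\tau)=M(r)(\tau)$ for $r\in R_e$, $s\in S_e$, $\tau\in\mathbf{Type}$; - $M_{att}(m\otimes p)=M(r)(p)(m)$ for $m\in M(r)(s)$ and $p\in S_o(s,\tau)$; - for $p\in R_o(r,\tau)$, $M_{ret}(p)\in M(r)(\tau)$ is the element that corresponds under the Yoneda lemma to $M(p)\colon\mathbf y(\tau)=M(\tau)\to M(r)$.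 Let a morphism of tuples $M\to N$ be a pair of profunctor morphisms $\theta_e\colon M_e\Rightarrow N_e$, $\theta_t\colon M_t\Rightarrow N_t$ with $N_{att}\circ(\theta_e\odot S_o)=\theta_t\circ M_{att}$ and $\theta_t\circ M_{ret}=N_{ret}$. Then $M\mapsto(M_e,M_t,M_{att},M_{ret})$, acting on morphisms by restriction, is an equivalence from the category of bimodules $R⇸S$ to the category of tuples, and it is bijective on objects. -/

import Mathlib

open CategoryTheory Opposite Limits

universe w

namespace AlgDB

/-! ### Profunctors -/

section Prof

/-- A profunctor `C ⇸ D` between small categories, i.e. a functor `Cᵒᵖ × D → Set`, in curried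
form. It is contravariant in its source `C` and covariant in its target `D`
(`CategoryTheory.Profunctor` uses the opposite variance). A morphism of profunctors is a natural
transformation. -/
abbrev Prof (C D : Type w) [SmallCategory C] [SmallCategory D] : Type (w + 1) :=
  Cᵒᵖ ⥤ D ⥤ Type w

variable {C D E : Type w} [SmallCategory C] [SmallCategory D] [SmallCategory E]

/-- A profunctor is algebraic if it is finite-product-preserving in its target. -/
def Prof.IsAlgebraic (P : Prof C D) : Prop :=
  ∀ c : Cᵒᵖ, PreservesFiniteProducts (P.obj c)

/-- The relation that generates the coend `∫^d P(c, d) × Q(d, e)`. -/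
inductive Prof.CompRel (P : Prof C D) (Q : Prof D E) (c : Cᵒᵖ) (e : E) :
    (Σ d : D, (P.obj c).obj d × (Q.obj (op d)).obj e) →
    (Σ d : D, (P.obj c).obj d × (Q.obj (op d)).obj e) → Prop
  | mk {d d' : D} (f : d ⟶ d') (p : (P.obj c).obj d) (q : (Q.obj (op d')).obj e) :
      Prof.CompRel P Q c e ⟨d', (P.obj c).map f p, q⟩ ⟨d, p, (Q.map f.op).app e q⟩

/-- The value of the composite profunctor: the coend `∫^d P(c, d) × Q(d, e)`. -/
def Prof.CompObj (P : Prof C D) (Q : Prof D E) (c : Cᵒᵖ) (e : E) : Type w :=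
  Quot (Prof.CompRel P Q c e)

/-- The class `p ⊗ q` in the coend. -/
def Prof.tmul {P : Prof C D} {Q : Prof D E} {c : Cᵒᵖ} {e : E} {d : D}
    (p : (P.obj c).obj d) (q : (Q.obj (op d)).obj e) : Prof.CompObj P Q c e :=
  Quot.mk _ ⟨d, p, q⟩

/-- Maps out of the coend, by their values on the classes `p ⊗ q`. -/
def Prof.compDesc {P : Prof C D} {Q : Prof D E} {c : Cᵒᵖ} {e : E} {X : Type w}
    (φ : ∀ d : D, (P.obj c).obj d → (Q.obj (op d)).obj e → X)
    (h : ∀ {d d' : D} (f : d ⟶ d') (p : (P.obj c).obj d) (q : (Q.obj (op d')).obj e),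
      φ d' ((P.obj c).map f p) q = φ d p ((Q.map f.op).app e q)) :
    Prof.CompObj P Q c e ⟶ X :=
  ↾(Quot.lift (fun x => φ x.1 x.2.1 x.2.2) (by rintro _ _ ⟨f, p, q⟩; exact h f p q))

theorem Prof.tmul_balanced {P : Prof C D} {Q : Prof D E} {c : Cᵒᵖ} {e : E} {d d' : D}
    (f : d ⟶ d') (p : (P.obj c).obj d) (q : (Q.obj (op d')).obj e) :
    Prof.tmul (P := P) ((P.obj c).map f p) q = Prof.tmul p ((Q.map f.op).app e q) :=
  Quot.sound (Prof.CompRel.mk f p q)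

theorem Prof.comp_ext {P : Prof C D} {Q : Prof D E} {c : Cᵒᵖ} {e : E} {X : Type w}
    {φ ψ : Prof.CompObj P Q c e ⟶ X}
    (h : ∀ (d : D) (p : (P.obj c).obj d) (q : (Q.obj (op d)).obj e),
      φ (Prof.tmul p q) = ψ (Prof.tmul p q)) : φ = ψ := by
  ext x
  obtain ⟨d, p, q⟩ := x
  exact h d p q

@[simp]
theorem Prof.compDesc_tmul {P : Prof C D} {Q : Prof D E} {c : Cᵒᵖ} {e : E} {X : Type w}
    (φ : ∀ d : D, (P.obj c).obj d → (Q.obj (op d)).obj e → X)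
    (h : ∀ {d d' : D} (f : d ⟶ d') (p : (P.obj c).obj d) (q : (Q.obj (op d')).obj e),
      φ d' ((P.obj c).map f p) q = φ d p ((Q.map f.op).app e q))
    {d : D} (p : (P.obj c).obj d) (q : (Q.obj (op d)).obj e) :
    Prof.compDesc φ h (Prof.tmul p q) = φ d p q := rfl

/-- The composite `P ⊙ Q : C ⇸ E` of `P : C ⇸ D` and `Q : D ⇸ E`. -/
def Prof.comp (P : Prof C D) (Q : Prof D E) : Prof C E where
  obj c :=
    { obj := fun e => Prof.CompObj P Q c e
      map := fun g => Prof.compDesc (fun d p q => Prof.tmul p ((Q.obj (op d)).map g q))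
        (by
          intro d d' f p q
          rw [Prof.tmul_balanced, NatTrans.naturality_apply])
      map_id := fun e => Prof.comp_ext (by intro d p q; simp; rfl)
      map_comp := fun g h => Prof.comp_ext (by intro d p q; simp; rfl) }
  map u :=
    { app := fun e => Prof.compDesc (fun d p q => Prof.tmul ((P.map u).app d p) q)
        (by
          intro d d' f p q
          rw [NatTrans.naturality_apply, Prof.tmul_balanced])
      naturality := fun e e' g => Prof.comp_ext (by intro d p q; rfl) }
  map_id c := by
    ext e : 2
    exact Prof.comp_ext (by intro d p q; simp; rfl)
  map_comp u v := by
    ext e : 2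
    exact Prof.comp_ext (by intro d p q; simp; rfl)

/-- The morphism `θ ⊙ Q : P ⊙ Q ⟶ P' ⊙ Q` induced by `θ : P ⟶ P'`. -/
def Prof.compMap {P P' : Prof C D} (θ : P ⟶ P') (Q : Prof D E) : P.comp Q ⟶ P'.comp Q where
  app c :=
    { app := fun e => Prof.compDesc (fun d p q => Prof.tmul ((θ.app c).app d p) q)
        (by
          intro d d' f p q
          rw [NatTrans.naturality_apply, Prof.tmul_balanced])
      naturality := fun e e' g => Prof.comp_ext (by intro d p q; rfl) }
  naturality c c' u := by
    ext e : 2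
    refine Prof.comp_ext ?_
    intro d p q
    have h := ConcreteCategory.congr_hom (NatTrans.congr_app (θ.naturality u) d) p
    exact congrArg (fun z => Prof.tmul z q) h

end Prof

/-! ### Collages -/

section Collage

variable {C D : Type w} [SmallCategory C] [SmallCategory D]

/-- The objects of the collage of a profunctor `P : C ⇸ D`: those of `C` and those of `D`. -/
inductive Collage (P : Prof C D) : Type w
  | inl (c : C) : Collage P
  | inr (d : D) : Collage P

/-- The morphisms of the collage: those of `C`, those of `D`, the elements of `P(c, d)` as
morphisms `c ⟶ d`, and none from objects of `D` to objects of `C`. -/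
def Collage.Hom (P : Prof C D) : Collage P → Collage P → Type w
  | .inl c, .inl c' => c ⟶ c'
  | .inl c, .inr d => (P.obj (op c)).obj d
  | .inr _, .inl _ => PEmpty
  | .inr d, .inr d' => d ⟶ d'

/-- Identities of the collage. -/
def Collage.id (P : Prof C D) : ∀ x : Collage P, Collage.Hom P x x
  | .inl c => 𝟙 c
  | .inr d => 𝟙 d

/-- Composition in the collage; it uses the action of `C` and `D` on `P`. -/
def Collage.comp (P : Prof C D) : ∀ {x y z : Collage P},
    Collage.Hom P x y → Collage.Hom P y z → Collage.Hom P x z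
  | .inl c, .inl c', .inl c'', f, g => (show c ⟶ c' from f) ≫ (show c' ⟶ c'' from g)
  | .inl c, .inl c', .inr d, f, p => (P.map (show c ⟶ c' from f).op).app d p
  | .inl c, .inr d, .inr d', p, g => (P.obj (op c)).map (show d ⟶ d' from g) p
  | .inr d, .inr d', .inr d'', f, g => (show d ⟶ d' from f) ≫ (show d' ⟶ d'' from g)
  | .inr _, .inl _, _, f, _ => f.elim
  | _, .inr _, .inl _, _, g => g.elim

instance Collage.category (P : Prof C D) : SmallCategory (Collage P) where
  Hom := Collage.Hom P
  id := Collage.id P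
  comp := Collage.comp P
  id_comp {x y} f := by
    cases x <;> cases y
    · exact Category.id_comp (obj := C) _
    · simp only [Collage.id, Collage.comp]
      erw [op_id, P.map_id]
      rfl
    · exact f.elim
    · exact Category.id_comp (obj := D) _
  comp_id {x y} f := by
    cases x <;> cases y
    · exact Category.comp_id (obj := C) _
    · simp only [Collage.id, Collage.comp]
      exact ConcreteCategory.congr_hom ((P.obj (op _)).map_id _) f
    · exact f.elim
    · exact Category.comp_id (obj := D) _
  assoc {a b c d} f g h := by
    rcases a with a | a <;> rcases b with b | b <;> rcases c with c | c <;> rcases d with d | d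
    all_goals first | exact f.elim | exact g.elim | exact h.elim | skip
    · exact Category.assoc (obj := C) _ _ _
    · exact ConcreteCategory.congr_hom (NatTrans.congr_app
        (P.map_comp (show b ⟶ c from g).op (show a ⟶ b from f).op) d)
        (show (P.obj (op c)).obj d from h)
    · exact (NatTrans.naturality_apply (P.map (show a ⟶ b from f).op) (show c ⟶ d from h)
        (show (P.obj (op b)).obj c from g)).symm
    · exact (ConcreteCategory.congr_hom
        ((P.obj (op a)).map_comp (show b ⟶ c from g) (show c ⟶ d from h))
        (show (P.obj (op a)).obj b from f)).symm
    · exact Category.assoc (obj := D) _ _ _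

/-- The inclusion of the source `C` into the collage of `P : C ⇸ D`. -/
def Collage.inclSource (P : Prof C D) : C ⥤ Collage P where
  obj := Collage.inl
  map f := f
  map_id _ := rfl
  map_comp _ _ := rfl

/-- The inclusion of the target `D` into the collage of `P : C ⇸ D`. -/
def Collage.inclTarget (P : Prof C D) : D ⥤ Collage P where
  obj := Collage.inr
  map f := f
  map_id _ := rfl
  map_comp _ _ := rfl

/-- An element of `P(c, d)`, seen as a morphism `c ⟶ d` of the collage. -/
def Collage.cross (P : Prof C D) {c : C} {d : D} (p : (P.obj (op c)).obj d) :
    (Collage.inclSource P).obj c ⟶ (Collage.inclTarget P).obj d := p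

theorem Collage.map_comp_cross (P : Prof C D) {c c' : C} {d : D} (f : c ⟶ c')
    (p : (P.obj (op c')).obj d) :
    Collage.cross P ((P.map f.op).app d p) = (Collage.inclSource P).map f ≫ Collage.cross P p :=
  rfl

theorem Collage.cross_comp_map (P : Prof C D) {c : C} {d d' : D}
    (p : (P.obj (op c)).obj d) (g : d ⟶ d') :
    Collage.cross P ((P.obj (op c)).map g p) =
      Collage.cross P p ≫ (Collage.inclTarget P).map g := rfl

end Collage

/-! ### Schemas and instances -/

/-- A database schema over the algebraic theory `T` (written `Type` in the literature): a small
category of entities with an algebraic profunctor, the observables, from it to `T`. -/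
structure Schema (T : Type w) [SmallCategory T] where
  Entity : Type w
  [category : SmallCategory Entity]
  obs : Prof Entity T
  algebraic : obs.IsAlgebraic

attribute [instance] Schema.category

variable {T : Type w} [SmallCategory T]

namespace Schema

/-- The collage of the observables profunctor of a schema. -/
abbrev Col (S : Schema T) : Type w := Collage S.obs

/-- The inclusion of the entity category into the collage. -/
abbrev inclE (S : Schema T) : S.Entity ⥤ S.Col := Collage.inclSource S.obs

/-- The inclusion of the theory of types into the collage. -/
abbrev inclT (S : Schema T) : T ⥤ S.Col := Collage.inclTarget S.obs

/-- An instance of `S` is a set-valued functor on the collage whose restriction to types preserves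
finite products. -/
def IsInstance (S : Schema T) : ObjectProperty (S.Col ⥤ Type w) :=
  fun I => PreservesFiniteProducts (S.inclT ⋙ I)

/-- The category of instances of `S`: a full subcategory of the functor category. -/
abbrev Inst (S : Schema T) : Type (w + 1) := S.IsInstance.FullSubcategory

theorem isInstance_coyoneda (S : Schema T) (x : S.Colᵒᵖ) : S.IsInstance (coyoneda.obj x) := by
  obtain ⟨x⟩ := x
  cases x with
  | inl s => exact S.algebraic (op s)
  | inr τ => exact (inferInstance : PreservesFiniteProducts (coyoneda.obj (op τ)))

/-- The Yoneda embedding `x ↦ Col(x, -)` of the opposite of the collage into instances. -/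
def yon (S : Schema T) : S.Colᵒᵖ ⥤ S.Inst :=
  S.IsInstance.lift coyoneda S.isInstance_coyoneda

end Schema

/-! ### Bimodules -/

/-- A bimodule `R ⇸ S`: a functor from the opposite of the collage of `R` to the instances of `S`
which agrees on types with the Yoneda embedding. -/
structure Bimodule (R S : Schema T) where
  functor : R.Colᵒᵖ ⥤ S.Inst
  comm : R.inclT.op ⋙ functor = S.inclT.op ⋙ S.yon

namespace Bimodule

variable {R S : Schema T}

/-- A morphism of bimodules: a natural transformation that restricts to the identity on types. -/
@[ext]
structure Hom (M N : Bimodule R S) where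
  nat : M.functor ⟶ N.functor
  restrict : Functor.whiskerLeft R.inclT.op nat = eqToHom (M.comm.trans N.comm.symm)

instance : Category (Bimodule R S) where
  Hom := Hom
  id M := ⟨𝟙 _, by simp⟩
  comp f g := ⟨f.nat ≫ g.nat, by
    rw [Functor.whiskerLeft_comp, f.restrict, g.restrict, eqToHom_trans]⟩

@[ext]
theorem hom_ext {M N : Bimodule R S} {f g : M ⟶ N} (h : f.nat = g.nat) : f = g := Hom.ext h

@[simp]
theorem id_nat (M : Bimodule R S) : (𝟙 M : M ⟶ M).nat = 𝟙 _ := rfl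

@[simp]
theorem comp_nat {M N K : Bimodule R S} (f : M ⟶ N) (g : N ⟶ K) :
    (f ≫ g).nat = f.nat ≫ g.nat := rfl

/-- The underlying profunctor `Col R ⇸ Col S` of a bimodule. -/
def prof (M : Bimodule R S) : Prof R.Col S.Col := M.functor ⋙ S.IsInstance.ι

/-- The identification of `M(τ)` with the representable instance on the type `τ`. -/
def typeHom (M : Bimodule R S) (τ : T) :
    S.yon.obj (S.inclT.op.obj (op τ)) ⟶ M.functor.obj (R.inclT.op.obj (op τ)) :=
  (eqToHom M.comm.symm).app (op τ)

end Bimodule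

/-! ### Componentwise bimodules -/

/-- The component data of a bimodule: a profunctor `e` between entity categories, an algebraic
profunctor `t` from the entities of `R` to types, and profunctor morphisms
`att : e ⊙ obs S ⟶ t` and `ret : obs R ⟶ t`. -/
structure Components (R S : Schema T) where
  e : Prof R.Entity S.Entity
  t : Prof R.Entity T
  algebraic : t.IsAlgebraic
  att : e.comp S.obs ⟶ t
  ret : R.obs ⟶ t

namespace Components

variable {R S : Schema T}

/-- A morphism of component data: a pair of profunctor morphisms compatible with `att` and
`ret`. -/
@[ext]
structure Hom (M N : Components R S) where
  e : M.e ⟶ N.e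
  t : M.t ⟶ N.t
  att : Prof.compMap e S.obs ≫ N.att = M.att ≫ t
  ret : M.ret ≫ t = N.ret

theorem compMap_id {C D E : Type w} [SmallCategory C] [SmallCategory D] [SmallCategory E]
    (P : Prof C D) (Q : Prof D E) : Prof.compMap (𝟙 P) Q = 𝟙 _ := by
  ext c e : 4
  exact Prof.comp_ext (fun _ _ _ => rfl)

theorem compMap_comp {C D E : Type w} [SmallCategory C] [SmallCategory D] [SmallCategory E]
    {P P' P'' : Prof C D} (θ : P ⟶ P') (η : P' ⟶ P'') (Q : Prof D E) :
    Prof.compMap (θ ≫ η) Q = Prof.compMap θ Q ≫ Prof.compMap η Q := by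
  ext c e : 4
  exact Prof.comp_ext (fun _ _ _ => rfl)

instance : Category (Components R S) where
  Hom := Hom
  id M := ⟨𝟙 _, 𝟙 _, by simp [compMap_id], by simp⟩
  comp f g := ⟨f.e ≫ g.e, f.t ≫ g.t, by
      rw [compMap_comp, Category.assoc, g.att, ← Category.assoc, f.att, Category.assoc], by
      rw [← Category.assoc, f.ret, g.ret]⟩

@[ext]
theorem hom_ext {M N : Components R S} {f g : M ⟶ N} (he : f.e = g.e) (ht : f.t = g.t) : f = g :=
  Hom.ext he ht

end Components

/-! ### The decomposition of a bimodule -/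

namespace Bimodule

variable {R S : Schema T}

theorem typeHom_naturality (M : Bimodule R S) {τ τ' : T} (g : τ ⟶ τ') :
    M.typeHom τ' ≫ M.functor.map (R.inclT.op.map g.op) =
      S.yon.map (S.inclT.op.map g.op) ≫ M.typeHom τ :=
  ((eqToHom M.comm.symm).naturality g.op).symm

theorem typeHom_comp {M N : Bimodule R S} (φ : M ⟶ N) (τ : T) :
    M.typeHom τ ≫ φ.nat.app (R.inclT.op.obj (op τ)) = N.typeHom τ := by
  have h := NatTrans.congr_app φ.restrict (op τ)
  rw [Functor.whiskerLeft_app] at h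
  rw [h]
  exact NatTrans.congr_app (eqToHom_trans M.comm.symm (M.comm.trans N.comm.symm)) (op τ)

/-- `M_e(r, s) = M(r)(s)` for entities `r` of `R` and `s` of `S`. -/
def entityPart (M : Bimodule R S) : Prof R.Entity S.Entity :=
  R.inclE.op ⋙ M.prof ⋙ (Functor.whiskeringLeft _ _ _).obj S.inclE

/-- `M_t(r, τ) = M(r)(τ)` for entities `r` of `R` and types `τ`. -/
def typePart (M : Bimodule R S) : Prof R.Entity T :=
  R.inclE.op ⋙ M.prof ⋙ (Functor.whiskeringLeft _ _ _).obj S.inclT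

theorem typePart_algebraic (M : Bimodule R S) : M.typePart.IsAlgebraic :=
  fun r => (M.functor.obj (R.inclE.op.obj r)).property

/-- `M_att(m ⊗ p) = M(r)(p)(m)` for `m ∈ M(r)(s)` and an observable `p : s ⟶ τ` of `S`. -/
def attPart (M : Bimodule R S) : M.entityPart.comp S.obs ⟶ M.typePart where
  app r :=
    { app := fun τ => Prof.compDesc
        (fun _ m p => (M.prof.obj (R.inclE.op.obj r)).map (Collage.cross S.obs p) m)
        (by
          intro s s' f m p
          exact (Functor.map_comp_apply (M.prof.obj (R.inclE.op.obj r))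
            (S.inclE.map f) (Collage.cross S.obs p) m).symm)
      naturality := fun τ τ' g => Prof.comp_ext (by
        intro s m p
        exact Functor.map_comp_apply (M.prof.obj (R.inclE.op.obj r))
          (Collage.cross S.obs p) (S.inclT.map g) m) }
  naturality r r' u := by
    ext τ : 2
    refine Prof.comp_ext ?_
    intro s m p
    exact (NatTrans.naturality_apply (M.prof.map (R.inclE.op.map u)) (Collage.cross S.obs p) m).symm

/-- For an observable `p : r ⟶ τ` of `R`, `M_ret(p) ∈ M(r)(τ)` is the element that corresponds,
under the Yoneda lemma, to the morphism of instances `M(p) : y(τ) = M(τ) ⟶ M(r)`. -/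
def retElt (M : Bimodule R S) {r : R.Entity} {τ : T} (p : (R.obs.obj (op r)).obj τ) :
    (M.typePart.obj (op r)).obj τ :=
  (M.typeHom τ ≫ M.functor.map (Collage.cross R.obs p).op).hom.app (S.inclT.obj τ)
    (𝟙 (S.inclT.obj τ))

theorem retElt_map_type (M : Bimodule R S) {r : R.Entity} {τ τ' : T} (g : τ ⟶ τ')
    (p : (R.obs.obj (op r)).obj τ) :
    M.retElt ((R.obs.obj (op r)).map g p) = (M.typePart.obj (op r)).map g (M.retElt p) := by
  have h : M.typeHom τ' ≫ M.functor.map (Collage.cross R.obs ((R.obs.obj (op r)).map g p)).op =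
      S.yon.map (S.inclT.op.map g.op) ≫
        (M.typeHom τ ≫ M.functor.map (Collage.cross R.obs p).op) := by
    rw [Collage.cross_comp_map, op_comp, Functor.map_comp, ← Category.assoc, ← Category.assoc]
    exact congrArg (· ≫ _) (M.typeHom_naturality g)
  have h₂ := NatTrans.naturality_apply
    (M.typeHom τ ≫ M.functor.map (Collage.cross R.obs p).op).hom (S.inclT.map g)
    (𝟙 (S.inclT.obj τ))
  refine (congrArg (fun k => k.hom.app (S.inclT.obj τ') (𝟙 (S.inclT.obj τ'))) h).trans
    (Eq.trans ?_ h₂)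
  exact congrArg ((M.typeHom τ ≫ M.functor.map (Collage.cross R.obs p).op).hom.app
    (S.inclT.obj τ')) ((Category.comp_id (S.inclT.map g)).trans (Category.id_comp _).symm)

theorem retElt_map_entity (M : Bimodule R S) {r r' : R.Entity} {τ : T} (u : r' ⟶ r)
    (p : (R.obs.obj (op r)).obj τ) :
    M.retElt ((R.obs.map u.op).app τ p) = (M.typePart.map u.op).app τ (M.retElt p) := by
  have h : M.typeHom τ ≫ M.functor.map (Collage.cross R.obs ((R.obs.map u.op).app τ p)).op =
      (M.typeHom τ ≫ M.functor.map (Collage.cross R.obs p).op) ≫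
        M.functor.map (R.inclE.map u).op := by
    rw [Collage.map_comp_cross, op_comp, Functor.map_comp, Category.assoc]
  exact congrArg (fun k => k.hom.app (S.inclT.obj τ) (𝟙 (S.inclT.obj τ))) h

theorem retElt_naturality {M N : Bimodule R S} (φ : M ⟶ N) {r : R.Entity} {τ : T}
    (p : (R.obs.obj (op r)).obj τ) :
    (φ.nat.app (R.inclE.op.obj (op r))).hom.app (S.inclT.obj τ) (M.retElt p) = N.retElt p := by
  have h : (M.typeHom τ ≫ M.functor.map (Collage.cross R.obs p).op) ≫
      φ.nat.app (R.inclE.op.obj (op r)) =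
        N.typeHom τ ≫ N.functor.map (Collage.cross R.obs p).op := by
    rw [← typeHom_comp φ τ, Category.assoc, Category.assoc]
    exact congrArg (_ ≫ ·) (φ.nat.naturality (Collage.cross R.obs p).op)
  exact congrArg (fun k => k.hom.app (S.inclT.obj τ) (𝟙 (S.inclT.obj τ))) h

/-- The profunctor morphism `M_ret : obs R ⟶ M_t`. -/
def retPart (M : Bimodule R S) : R.obs ⟶ M.typePart where
  app r :=
    { app := fun τ => ↾(fun p => M.retElt (r := r.unop) p)
      naturality := fun τ τ' g => by
        ext p
        exact M.retElt_map_type g p }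
  naturality r r' u := by
    ext τ p
    exact M.retElt_map_entity u.unop p

/-- The decomposition functor, which sends a bimodule `M` to `(M_e, M_t, M_att, M_ret)` and a
morphism of bimodules to its restrictions. -/
def decompose (R S : Schema T) : Bimodule R S ⥤ Components R S where
  obj M :=
    { e := M.entityPart
      t := M.typePart
      algebraic := M.typePart_algebraic
      att := M.attPart
      ret := M.retPart }
  map {M N} φ :=
    { e := Functor.whiskerLeft R.inclE.op (Functor.whiskerRight
        (Functor.whiskerRight φ.nat S.IsInstance.ι) ((Functor.whiskeringLeft _ _ _).obj S.inclE))
      t := Functor.whiskerLeft R.inclE.op (Functor.whiskerRight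
        (Functor.whiskerRight φ.nat S.IsInstance.ι) ((Functor.whiskeringLeft _ _ _).obj S.inclT))
      att := by
        ext r τ : 4
        refine Prof.comp_ext ?_
        intro s m p
        exact (NatTrans.naturality_apply (φ.nat.app (R.inclE.op.obj r)).hom
          (Collage.cross S.obs p) m).symm
      ret := by
        ext r τ p
        exact retElt_naturality φ p }
  map_id M := rfl
  map_comp f g := rfl

end Bimodule

end AlgDB

/-! A collage contains its two categories and the elements of its profunctor, so a functor on it is
two functors and a compatible action of those elements, and a natural transformation on it is two
transformations commuting with that action. This is used twice. On the collage of `S`: the instance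
`M(r)` amounts to `M_e(r, -)`, `M_t(r, -)` and maps `M_e(r, s) × S_o(s, τ) → M_t(r, τ)`; the coend
relation says exactly that these maps are natural in `s`, so they form `M_att`. On the collage of
`R`: the values on types are prescribed representables, so what remains is a functor on entities and
morphisms `y(τ) ⟶ M(r)` for each observable of `R`; by the Yoneda lemma these are elements of
`M_t(r, τ)`, that is, `M_ret`. For morphisms this gives full faithfulness (`homOfComponents`), for
objects strict surjectivity (`decompose_toBimodule`). Injectivity on objects lifts an equality of
tuples through full faithfulness to an isomorphism all of whose components are transported
identities, which forces equality. -/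

namespace AlgDB

/-! ### Functors and natural transformations on a collage -/

namespace Collage

section

universe v u

variable {C D : Type w} [SmallCategory C] [SmallCategory D] (P : Prof C D)
  {A : Type u} [Category.{v} A]

/-- A functor on the collage of `P`, from functors on its source and its target and the images of
the elements of `P`. -/
def lift (F : C ⥤ A) (G : D ⥤ A)
    (φ : ∀ {c : C} {d : D}, (P.obj (op c)).obj d → (F.obj c ⟶ G.obj d))
    (hF : ∀ {c c' : C} {d : D} (f : c ⟶ c') (p : (P.obj (op c')).obj d),
      φ ((P.map f.op).app d p) = F.map f ≫ φ p)
    (hG : ∀ {c : C} {d d' : D} (p : (P.obj (op c)).obj d) (g : d ⟶ d'),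
      φ ((P.obj (op c)).map g p) = φ p ≫ G.map g) : Collage P ⥤ A where
  obj
    | .inl c => F.obj c
    | .inr d => G.obj d
  map {x y} f :=
    match x, y, f with
    | .inl c, .inl c', f => F.map (show c ⟶ c' from f)
    | .inl c, .inr d, p => φ (show (P.obj (op c)).obj d from p)
    | .inr d, .inr d', g => G.map (show d ⟶ d' from g)
    | .inr _, .inl _, f => PEmpty.elim f
  map_id x := by
    cases x with
    | inl c => exact F.map_id c
    | inr d => exact G.map_id d
  map_comp {x y z} f g := by
    rcases x with x | x <;> rcases y with y | y <;> rcases z with z | z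
    all_goals first | exact PEmpty.elim f | exact PEmpty.elim g | skip
    · exact F.map_comp (show x ⟶ y from f) (show y ⟶ z from g)
    · exact hF (show x ⟶ y from f) g
    · exact hG (show (P.obj (op x)).obj y from f) g
    · exact G.map_comp (show x ⟶ y from f) (show y ⟶ z from g)

variable {P}

/-- A natural transformation between functors on a collage, from its restrictions. -/
def natTransMk {F G : Collage P ⥤ A} (α : inclSource P ⋙ F ⟶ inclSource P ⋙ G)
    (β : inclTarget P ⋙ F ⟶ inclTarget P ⋙ G)
    (h : ∀ {c : C} {d : D} (p : (P.obj (op c)).obj d),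
      F.map (cross P p) ≫ β.app d = α.app c ≫ G.map (cross P p)) : F ⟶ G where
  app
    | .inl c => α.app c
    | .inr d => β.app d
  naturality {x y} f := by
    rcases x with x | x <;> rcases y with y | y
    · exact α.naturality (show x ⟶ y from f)
    · exact h f
    · exact PEmpty.elim f
    · exact β.naturality (show x ⟶ y from f)

/-- A natural transformation between contravariant functors on a collage, from its
restrictions. -/
def natTransMkOp {F G : (Collage P)ᵒᵖ ⥤ A}
    (α : (inclSource P).op ⋙ F ⟶ (inclSource P).op ⋙ G)
    (β : (inclTarget P).op ⋙ F ⟶ (inclTarget P).op ⋙ G)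
    (h : ∀ {c : C} {d : D} (p : (P.obj (op c)).obj d),
      F.map (cross P p).op ≫ α.app (op c) = β.app (op d) ≫ G.map (cross P p).op) : F ⟶ G where
  app
    | op (.inl c) => α.app (op c)
    | op (.inr d) => β.app (op d)
  naturality {x y} f := by
    obtain ⟨x⟩ := x
    obtain ⟨y⟩ := y
    rcases x with x | x <;> rcases y with y | y
    · exact α.naturality (show y ⟶ x from f.unop).op
    · exact PEmpty.elim f.unop
    · exact h f.unop
    · exact β.naturality (show y ⟶ x from f.unop).op

theorem natTrans_ext {F G : Collage P ⥤ A} {α β : F ⟶ G}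
    (hs : Functor.whiskerLeft (inclSource P) α = Functor.whiskerLeft (inclSource P) β)
    (ht : Functor.whiskerLeft (inclTarget P) α = Functor.whiskerLeft (inclTarget P) β) :
    α = β := by
  ext x
  cases x with
  | inl c => exact NatTrans.congr_app hs c
  | inr d => exact NatTrans.congr_app ht d

end

end Collage

namespace Schema

variable {T : Type w} [SmallCategory T] {S : Schema T}

/-- Morphisms out of a representable instance agree if they agree on the identity. -/
theorem yon_hom_ext {x : S.Col} {I : S.Inst} {f g : S.yon.obj (op x) ⟶ I}
    (h : f.hom.app x (𝟙 x) = g.hom.app x (𝟙 x)) : f = g :=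
  ObjectProperty.hom_ext _ (coyonedaEquiv.injective h)

end Schema

/-! ### The decomposition functor is fully faithful -/

namespace Bimodule

variable {T : Type w} [SmallCategory T] {R S : Schema T}

theorem nat_app_type {M N : Bimodule R S} (φ : M ⟶ N) (τ : T) :
    φ.nat.app (R.inclT.op.obj (op τ)) =
      (eqToHom (M.comm.trans N.comm.symm)).app (op τ) :=
  NatTrans.congr_app φ.restrict (op τ)

/-- At an entity, a component is determined by its restrictions to entities and types of `S`, which
`decompose` records; at a type, it is prescribed. -/
instance decompose_faithful : (decompose R S).Faithful where
  map_injective {M N} φ ψ h := by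
    apply hom_ext
    ext x : 2
    obtain ⟨r | τ⟩ := x
    · apply ObjectProperty.hom_ext
      apply Collage.natTrans_ext
      · exact NatTrans.congr_app (congrArg Components.Hom.e h) (op r)
      · exact NatTrans.congr_app (congrArg Components.Hom.t h) (op r)
    · exact (nat_app_type φ τ).trans (nat_app_type ψ τ).symm

/-- The restriction to entities of the morphism of bimodules with given components. -/
def entityNat {M N : Bimodule R S} (θ : (decompose R S).obj M ⟶ (decompose R S).obj N) :
    R.inclE.op ⋙ M.functor ⟶ R.inclE.op ⋙ N.functor where
  app r := ObjectProperty.homMk (Collage.natTransMk (θ.e.app r) (θ.t.app r) (by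
    intro s τ p
    ext m
    -- Naturality along the observable `p`, evaluated at `m`, is compatibility with `att` evaluated
    -- at `m ⊗ p`.
    exact (ConcreteCategory.congr_hom (NatTrans.congr_app (NatTrans.congr_app θ.att r) τ)
      (Prof.tmul (P := M.entityPart) m p)).symm))
  naturality r r' u := by
    apply ObjectProperty.hom_ext
    apply Collage.natTrans_ext
    · exact θ.e.naturality u
    · exact θ.t.naturality u

theorem typeHom_isIso (M : Bimodule R S) (τ : T) : IsIso (M.typeHom τ) :=
  inferInstanceAs (IsIso ((eqToHom M.comm.symm).app (op τ)))

theorem typeHom_eqToHom (M N : Bimodule R S) (τ : T) :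
    M.typeHom τ ≫ (eqToHom (M.comm.trans N.comm.symm)).app (op τ) = N.typeHom τ :=
  NatTrans.congr_app (eqToHom_trans M.comm.symm (M.comm.trans N.comm.symm)) (op τ)

/-- The morphism of bimodules with given components. -/
def homOfComponents {M N : Bimodule R S}
    (θ : (decompose R S).obj M ⟶ (decompose R S).obj N) : M ⟶ N where
  nat := Collage.natTransMkOp (entityNat θ) (eqToHom (M.comm.trans N.comm.symm)) (by
    intro r τ p
    have := M.typeHom_isIso τ
    -- `M(τ)` equals `y(τ)` only propositionally; precomposing with `typeHom` makes the source a
    -- literal representable, so that Yoneda reduces the square to `θ_t (M_ret p) = N_ret p`.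
    rw [← cancel_epi (M.typeHom τ), ← Category.assoc, ← Category.assoc]
    refine Eq.trans ?_ (congrArg (· ≫ N.functor.map (Collage.cross R.obs p).op)
      (typeHom_eqToHom M N τ)).symm
    apply Schema.yon_hom_ext
    exact ConcreteCategory.congr_hom (NatTrans.congr_app (NatTrans.congr_app θ.ret (op r)) τ) p)
  restrict := by
    ext τ : 2
    rfl

instance decompose_full : (decompose R S).Full where
  map_surjective θ := ⟨homOfComponents θ, rfl⟩

end Bimodule

/-! ### The bimodule with given components -/

namespace Components

variable {T : Type w} [SmallCategory T] {R S : Schema T}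

/-- The instance `M(r)` with given components. -/
def entityInst (M : Components R S) (r : R.Entityᵒᵖ) : S.Inst where
  obj := Collage.lift S.obs (M.e.obj r) (M.t.obj r)
    (fun {s τ} p => ↾(fun m => (M.att.app r).app τ (Prof.tmul (P := M.e) m p)))
    (by
      intro s s' τ f p
      ext m
      -- Functoriality along entity morphisms is the coend relation; along type morphisms, below, it
      -- is naturality of `att`.
      exact congrArg ((M.att.app r).app τ) (Prof.tmul_balanced f m p).symm)
    (by
      intro s τ τ' p g
      ext m
      exact NatTrans.naturality_apply (M.att.app r) g (Prof.tmul (P := M.e) m p))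
  property := M.algebraic r

/-- The restriction to entities of the bimodule with given components. -/
def entityFunctor (M : Components R S) : R.Entityᵒᵖ ⥤ S.Inst where
  obj := M.entityInst
  map {r r'} u := ObjectProperty.homMk (Collage.natTransMk (M.e.map u) (M.t.map u) (by
    intro s τ p
    ext m
    exact (ConcreteCategory.congr_hom (NatTrans.congr_app (M.att.naturality u) τ)
      (Prof.tmul (P := M.e) m p)).symm))
  map_id r := by
    apply ObjectProperty.hom_ext
    apply Collage.natTrans_ext
    · exact M.e.map_id r
    · exact M.t.map_id r
  map_comp u v := by
    apply ObjectProperty.hom_ext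
    apply Collage.natTrans_ext
    · exact M.e.map_comp u v
    · exact M.t.map_comp u v

/-- The morphism of instances `M(p) : y(τ) ⟶ M(r)` for an observable `p : r ⟶ τ` of `R`. -/
def crossHom (M : Components R S) {r : R.Entity} {τ : T} (p : (R.obs.obj (op r)).obj τ) :
    S.yon.obj (S.inclT.op.obj (op τ)) ⟶ M.entityInst (op r) :=
  ObjectProperty.homMk (coyonedaEquiv.symm
    (show (M.entityInst (op r)).obj.obj (S.inclT.obj τ) from (M.ret.app (op r)).app τ p))

theorem crossHom_app_id (M : Components R S) {r : R.Entity} {τ : T}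
    (p : (R.obs.obj (op r)).obj τ) :
    (M.crossHom p).hom.app (S.inclT.obj τ) (𝟙 (S.inclT.obj τ)) =
      (M.ret.app (op r)).app τ p :=
  coyonedaEquiv.apply_symm_apply
    (show (M.entityInst (op r)).obj.obj (S.inclT.obj τ) from (M.ret.app (op r)).app τ p)

/-- The bimodule with given components. -/
def toBimodule (M : Components R S) : Bimodule R S where
  -- `Collage.lift` is covariant, so the functor is built with values in the opposite of instances
  -- and then turned around by `leftOp`.
  functor := (Collage.lift R.obs M.entityFunctor.rightOp (S.inclT.op ⋙ S.yon).rightOp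
    (fun p => (M.crossHom p).op)
    (by
      intro r r' τ f p
      apply Quiver.Hom.unop_inj
      apply Schema.yon_hom_ext
      refine (M.crossHom_app_id _).trans (Eq.trans ?_
        (congrArg ((M.t.map f.op).app τ) (M.crossHom_app_id p)).symm)
      -- After Yoneda, both compatibilities of `crossHom` become naturality of `ret`: here in the
      -- entity, below in the type.
      exact ConcreteCategory.congr_hom (NatTrans.congr_app (M.ret.naturality f.op) τ) p)
    (by
      intro r τ τ' p g
      apply Quiver.Hom.unop_inj
      apply Schema.yon_hom_ext
      refine (M.crossHom_app_id _).trans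
        ((NatTrans.naturality_apply (M.ret.app (op r)) g p).trans ?_)
      -- The Yoneda image of `g` sends the identity to `g ≫ 𝟙`, hence this correction.
      exact congrArg (fun k => (M.t.obj (op r)).map k ((M.ret.app (op r)).app τ p))
        (Category.comp_id g).symm)).leftOp
  comm := rfl

/-- Since `comm` is `rfl` for this bimodule, `typeHom` reduces to an identity and only `crossHom` is
left. -/
theorem retElt_toBimodule (M : Components R S) {r : R.Entity} {τ : T}
    (p : (R.obs.obj (op r)).obj τ) :
    M.toBimodule.retElt p = (M.ret.app (op r)).app τ p :=
  M.crossHom_app_id p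

theorem decompose_toBimodule (M : Components R S) :
    (Bimodule.decompose R S).obj M.toBimodule = M := by
  have hatt : M.toBimodule.attPart = M.att := by
    ext r τ : 4
    exact Prof.comp_ext (fun _ _ _ => rfl)
  have hret : M.toBimodule.retPart = M.ret := by
    ext r τ p
    exact M.retElt_toBimodule p
  -- The two profunctors agree definitionally, so `att` and `ret` can be compared without transport.
  exact congrArg₂ (fun att ret => (⟨M.e, M.t, M.algebraic, att, ret⟩ : Components R S)) hatt hret

end Components

/-! ### The decomposition functor is bijective on objects -/

namespace Components

variable {T : Type w} [SmallCategory T] {R S : Schema T}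

theorem eqToHom_e {M N : Components R S} (h : M = N) :
    (eqToHom h).e = eqToHom (congrArg Components.e h) := by
  subst h
  rfl

theorem eqToHom_t {M N : Components R S} (h : M = N) :
    (eqToHom h).t = eqToHom (congrArg Components.t h) := by
  subst h
  rfl

end Components

namespace Bimodule

variable {T : Type w} [SmallCategory T] {R S : Schema T}

theorem ext_functor {M N : Bimodule R S} (h : M.functor = N.functor) : M = N := by
  cases M
  cases N
  cases h
  rfl

/-- An isomorphism of set-valued functors whose components are identities is an identity. -/
theorem exists_eqToHom_of_app {C : Type w} [SmallCategory C] {F G : C ⥤ Type w} (e : F ≅ G)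
    (h : ∀ x, ∃ hx : F.obj x = G.obj x, e.hom.app x = eqToHom hx) :
    ∃ hFG : F = G, e.hom = eqToHom hFG := by
  have hFG : F = G := Functor.ext_of_iso e (fun x => (h x).1) (fun x => (h x).2)
  refine ⟨hFG, ?_⟩
  ext x : 2
  rw [(h x).2, eqToHom_app]

/-- Being an instance is a proposition, so equality of the underlying functors suffices. -/
theorem exists_hom_eqToHom {I J : S.Inst} (e : I ≅ J)
    (h : ∃ hIJ : I.obj = J.obj, e.hom.hom = eqToHom hIJ) :
    ∃ hIJ : I = J, e.hom = eqToHom hIJ := by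
  obtain ⟨h, he⟩ := h
  have hIJ : I = J := ObjectProperty.FullSubcategory.ext h
  refine ⟨hIJ, ObjectProperty.hom_ext _ ?_⟩
  rw [he, ObjectProperty.eqToHom_hom]

theorem decompose_obj_injective :
    Function.Injective (decompose R S).obj := by
  intro M N h
  -- Comparing the functors directly would need heterogeneous equalities; this isomorphism lying
  -- over `h` carries the comparison instead.
  let φ : M ≅ N := (decompose R S).preimageIso (eqToIso h)
  have hφ : (decompose R S).map φ.hom = eqToHom h := (decompose R S).map_preimage _
  let e : M.functor ≅ N.functor :=
    ⟨φ.hom.nat, φ.inv.nat, congrArg Hom.nat φ.hom_inv_id, congrArg Hom.nat φ.inv_hom_id⟩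
  -- The principle of `exists_eqToHom_of_app` acts at two levels: inside each `M(r)`, over the
  -- collage of `S`, and then for the whole functor, over the collage of `R`.
  have he : ∀ x, ∃ hx : M.functor.obj x = N.functor.obj x, e.hom.app x = eqToHom hx := by
    rintro ⟨r | τ⟩
    · apply exists_hom_eqToHom (e.app (op (Collage.inl r)))
      apply exists_eqToHom_of_app (S.IsInstance.ι.mapIso (e.app (op (Collage.inl r))))
      rintro (s | τ)
      · refine ⟨congrArg (fun K : Components R S => (K.e.obj (op r)).obj s) h, ?_⟩
        have := NatTrans.congr_app (NatTrans.congr_app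
          ((congrArg Components.Hom.e hφ).trans (Components.eqToHom_e h)) (op r)) s
        rw [eqToHom_app, eqToHom_app] at this
        exact this
      · refine ⟨congrArg (fun K : Components R S => (K.t.obj (op r)).obj τ) h, ?_⟩
        have := NatTrans.congr_app (NatTrans.congr_app
          ((congrArg Components.Hom.t hφ).trans (Components.eqToHom_t h)) (op r)) τ
        rw [eqToHom_app, eqToHom_app] at this
        exact this
    -- On types nothing depends on `h`: a morphism of bimodules is a transported identity there by
    -- definition.
    · exact ⟨_, (nat_app_type φ.hom τ).trans (eqToHom_app _ _)⟩
  exact ext_functor (Functor.ext_of_iso e (fun x => (he x).1) (fun x => (he x).2))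

theorem decompose_obj_bijective : Function.Bijective (decompose R S).obj :=
  ⟨decompose_obj_injective, fun K => ⟨K.toBimodule, K.decompose_toBimodule⟩⟩

instance decompose_essSurj : (decompose R S).EssSurj where
  mem_essImage K := ⟨K.toBimodule, ⟨eqToIso K.decompose_toBimodule⟩⟩

end Bimodule

end AlgDB

theorem mainTheorem10 {T : Type w} [SmallCategory T] [HasFiniteProducts T]
    (R S : AlgDB.Schema T) :
    (AlgDB.Bimodule.decompose R S).IsEquivalence ∧
      Function.Bijective (AlgDB.Bimodule.decompose R S).obj :=
  ⟨{}, AlgDB.Bimodule.decompose_obj_bijective⟩
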